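/- **Lemma 3.7 (Kernel decomposition).** Let $D\subset\mathbb{R}^n$ and $\Omega\subset\mathbb{R}^m$ be bounded open sets, and let $\Phi\in C(\overline{D};L^2(\Omega))$, i.e. $\Phi:\overline D\times\Omega\to\mathbb R$ is measurable, $\Phi(y,\cdot)\in L^2(\Omega)$ for every $y\in\overline D$, and $\|\Phi(z,\cdot)-\Phi(y,\cdot)\|_{L^2(\Omega)}\to 0$ as $z\to y$ in $\overline D$. Let $K_\Phi(y,z)=\int_\Omega \Phi(y,x)\Phi(z,x)\,dx$ and let $T_\Phi:L^2(D)\to L^2(D)$ be the integral operator $(T_\Phi\phi)(y)=\int_D K_\Phi(y,z)\phi(z)\,dz$. Then all the eigenvalues of $T_\Phi$ can be listed in a sequence $\{\lambda_k\}_{k=1}^\infty$, each nonzero eigenvalue being repeated according to its multiplicity (the dimension of its eigenspace), while the entry $0$ may occur any number of times (in particular, a finite list is continued by zeros). For every such sequence, in any order, all $\lambda_k$ are non-negative, and for each $N\in\mathbb{N}$ (including $N=0$) there exist $\Psi\in C(\overline{D};\mathbb{R}^N)$ and $\Xi\in L^2(\Omega;\mathbb{R}^N)$ such that $$\|\Phi-\Psi\cdot\Xi\|_{L^2(D\times\Omega)}^2=\sum_{k=N+1}^\infty\lambda_k<\infty,$$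 where $(\Psi\cdot\Xi)(y,x)=\Psi(y)\cdot\Xi(x)$. -/

import Mathlib

open MeasureTheory Filter Topology

noncomputable section

/-- The class `C(D̄; L²(Ω))`: functions `Φ`, (Lebesgue) measurable on `D̄ × Ω`, with
`Φ(y, ·) ∈ L²(Ω)` for every `y ∈ D̄` and `‖Φ(y, ·) - Φ(z, ·)‖_{L²(Ω)} → 0` as `z → y` in `D̄`.
Only the values on `D̄ × Ω` matter. -/
structure MemCL2 {n m : ℕ} (D : Set (EuclideanSpace ℝ (Fin n)))
    (Ω : Set (EuclideanSpace ℝ (Fin m)))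
    (Φ : EuclideanSpace ℝ (Fin n) → EuclideanSpace ℝ (Fin m) → ℝ) : Prop where
  aestronglyMeasurable : AEStronglyMeasurable (Function.uncurry Φ)
    ((volume.restrict (closure D)).prod (volume.restrict Ω))
  memLp : ∀ y ∈ closure D, MemLp (Φ y) 2 (volume.restrict Ω)
  tendsto : ∀ y ∈ closure D,
    Tendsto (fun z => eLpNorm (Φ z - Φ y) 2 (volume.restrict Ω)) (𝓝[closure D] y) (𝓝 0)

/-- Mercer's kernel `K_Φ(y, z) = ∫_Ω Φ(y, x) Φ(z, x) dx`. -/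
def mercerKernel {n m : ℕ} (Ω : Set (EuclideanSpace ℝ (Fin m)))
    (Φ : EuclideanSpace ℝ (Fin n) → EuclideanSpace ℝ (Fin m) → ℝ)
    (y z : EuclideanSpace ℝ (Fin n)) : ℝ :=
  ∫ x in Ω, Φ y x * Φ z x

theorem MemCL2.continuousOn_mercerKernel {n m : ℕ} {D : Set (EuclideanSpace ℝ (Fin n))}
    {Ω : Set (EuclideanSpace ℝ (Fin m))}
    {Φ : EuclideanSpace ℝ (Fin n) → EuclideanSpace ℝ (Fin m) → ℝ} (hΦ : MemCL2 D Ω Φ) :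
    ContinuousOn (Function.uncurry (mercerKernel Ω Φ)) (closure D ×ˢ closure D) := by
  classical
  let F : closure D → Lp ℝ 2 (volume.restrict Ω) := fun y => (hΦ.memLp y y.2).toLp
  have hF : Continuous F := by
    rw [continuous_iff_continuousAt]
    intro y
    rw [ContinuousAt, Lp.tendsto_Lp_iff_tendsto_eLpNorm']
    have h := (hΦ.tendsto y y.2).comp (tendsto_nhdsWithin_iff.2
      ⟨(continuous_subtype_val.tendsto y), Eventually.of_forall fun z => z.2⟩)
    refine h.congr fun z => ?_
    refine eLpNorm_congr_ae ?_
    filter_upwards [(hΦ.memLp z z.2).coeFn_toLp, (hΦ.memLp y y.2).coeFn_toLp] with x h1 h2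
    simp [F, h1, h2]
  have hK : ∀ y z : closure D, mercerKernel Ω Φ y z = inner ℝ (F z) (F y) := by
    intro y z
    rw [L2.inner_def]
    refine integral_congr_ae ?_
    filter_upwards [(hΦ.memLp z z.2).coeFn_toLp, (hΦ.memLp y y.2).coeFn_toLp] with x h1 h2
    simp [F, h1, h2]
  rw [continuousOn_iff_continuous_domRestrict]
  have hc : Continuous fun p : (closure D ×ˢ closure D : Set _) =>
      (inner ℝ (F ⟨p.1.2, p.2.2⟩) (F ⟨p.1.1, p.2.1⟩) : ℝ) := by
    refine Continuous.inner (hF.comp ?_) (hF.comp ?_)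
    · exact (continuous_snd.comp continuous_subtype_val).subtype_mk _
    · exact (continuous_fst.comp continuous_subtype_val).subtype_mk _
  refine hc.congr fun p => ?_
  exact (hK ⟨p.1.1, p.2.1⟩ ⟨p.1.2, p.2.2⟩).symm

section Operator

variable {n m : ℕ} {D : Set (EuclideanSpace ℝ (Fin n))} {Ω : Set (EuclideanSpace ℝ (Fin m))}
  {Φ : EuclideanSpace ℝ (Fin n) → EuclideanSpace ℝ (Fin m) → ℝ}

theorem MemCL2.exists_bound (hΦ : MemCL2 D Ω Φ) (hDb : Bornology.IsBounded D) :
    ∃ C : ℝ, ∀ y ∈ D, ∀ z ∈ D, ‖mercerKernel Ω Φ y z‖ ≤ C := by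
  have hc : IsCompact (closure D) := hDb.isCompact_closure
  obtain ⟨C, hC⟩ := (hc.prod hc).exists_bound_of_continuousOn hΦ.continuousOn_mercerKernel
  exact ⟨C, fun y hy z hz => hC (y, z) ⟨subset_closure hy, subset_closure hz⟩⟩

theorem MemCL2.aestronglyMeasurable_kernel (hΦ : MemCL2 D Ω Φ) (hD : IsOpen D) :
    AEStronglyMeasurable (Function.uncurry (mercerKernel Ω Φ))
      ((volume.restrict D).prod (volume.restrict D)) := by
  rw [Measure.prod_restrict]
  exact (hΦ.continuousOn_mercerKernel.mono
    (Set.prod_mono subset_closure subset_closure)).aestronglyMeasurable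
    (hD.measurableSet.prod hD.measurableSet)

theorem MemCL2.integrable_kernel_mul (hΦ : MemCL2 D Ω Φ) (hD : IsOpen D)
    (hDb : Bornology.IsBounded D) (φ : Lp ℝ 2 (volume.restrict D))
    {y : EuclideanSpace ℝ (Fin n)} (hy : y ∈ D) :
    Integrable (fun z => mercerKernel Ω Φ y z * φ z) (volume.restrict D) := by
  have : IsFiniteMeasure (volume.restrict D) :=
    isFiniteMeasure_restrict.2 hDb.measure_lt_top.ne
  obtain ⟨C, hC⟩ := hΦ.exists_bound hDb
  have hφ : Integrable φ (volume.restrict D) := (Lp.memLp φ).integrable (by norm_num)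
  refine hφ.bdd_mul (c := C) ?_ ?_
  · refine ContinuousOn.aestronglyMeasurable ?_ hD.measurableSet
    exact hΦ.continuousOn_mercerKernel.comp (f := fun z => (y, z)) (by fun_prop)
      fun z hz => ⟨subset_closure hy, subset_closure hz⟩
  · filter_upwards [ae_restrict_mem hD.measurableSet] with z hz using hC y hy z hz

theorem MemCL2.memLp_integral (hΦ : MemCL2 D Ω Φ) (hD : IsOpen D)
    (hDb : Bornology.IsBounded D) (φ : Lp ℝ 2 (volume.restrict D)) :
    MemLp (fun y => ∫ z in D, mercerKernel Ω Φ y z * φ z) 2 (volume.restrict D) := by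
  have : IsFiniteMeasure (volume.restrict D) :=
    isFiniteMeasure_restrict.2 hDb.measure_lt_top.ne
  obtain ⟨C, hC⟩ := hΦ.exists_bound hDb
  have hφ : Integrable φ (volume.restrict D) := (Lp.memLp φ).integrable (by norm_num)
  refine MemLp.of_bound ?_ (∫ z in D, C * ‖φ z‖) ?_
  · have h2 : AEStronglyMeasurable (fun p : EuclideanSpace ℝ (Fin n) × EuclideanSpace ℝ (Fin n) =>
        φ p.2) ((volume.restrict D).prod (volume.restrict D)) :=
      (Lp.aestronglyMeasurable φ).comp_snd
    exact ((hΦ.aestronglyMeasurable_kernel hD).mul h2).integral_prod_right'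
  · filter_upwards [ae_restrict_mem hD.measurableSet] with y hy
    refine norm_integral_le_of_norm_le (hφ.norm.const_mul C) ?_
    filter_upwards [ae_restrict_mem hD.measurableSet] with z hz
    rw [norm_mul]
    exact mul_le_mul_of_nonneg_right (hC y hy z hz) (norm_nonneg _)

/-- The integral operator `T_Φ : L²(D) → L²(D)`, `(T_Φ φ)(y) = ∫_D K_Φ(y, z) φ(z) dz`,
for `Φ ∈ C(D̄; L²(Ω))` and `D` open and bounded. -/
def mercerOperator (hΦ : MemCL2 D Ω Φ) (hD : IsOpen D) (hDb : Bornology.IsBounded D) :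
    Lp ℝ 2 (volume.restrict D) →ₗ[ℝ] Lp ℝ 2 (volume.restrict D) where
  toFun φ := (hΦ.memLp_integral hD hDb φ).toLp
  map_add' φ ψ := by
    rw [← MemLp.toLp_add, MemLp.toLp_eq_toLp_iff]
    filter_upwards [ae_restrict_mem hD.measurableSet] with y hy
    rw [Pi.add_apply, ← integral_add (hΦ.integrable_kernel_mul hD hDb φ hy)
      (hΦ.integrable_kernel_mul hD hDb ψ hy)]
    refine integral_congr_ae ?_
    filter_upwards [Lp.coeFn_add φ ψ] with z hz
    rw [hz, Pi.add_apply, mul_add]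
  map_smul' c φ := by
    rw [RingHom.id_apply, ← MemLp.toLp_const_smul, MemLp.toLp_eq_toLp_iff]
    refine Eventually.of_forall fun y => ?_
    simp only [Pi.smul_apply]
    rw [← integral_smul]
    refine integral_congr_ae ?_
    filter_upwards [Lp.coeFn_smul c φ] with z hz
    rw [hz, Pi.smul_apply, smul_eq_mul, smul_eq_mul]
    ring

end Operator

/-- `ev` lists all the eigenvalues of `T`, in any order: each nonzero real `μ` occurs in the
list exactly as often as the dimension of its eigenspace (never, if `μ` is not an eigenvalue).
The entry `0` may occur any number of times; so `ev` may be the list along an orthonormal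
basis of eigenvectors, or the nonincreasing list, continued by zeros if it would be finite. -/
def IsEigenvalueSequence {H : Type} [AddCommGroup H] [Module ℝ H] (T : H →ₗ[ℝ] H)
    (ev : ℕ → ℝ) : Prop :=
  ∀ μ : ℝ, μ ≠ 0 → Cardinal.mk {k : ℕ // ev k = μ} = Module.rank ℝ (Module.End.eigenspace T μ)

end

/-! Regard `Φ` as an element `f` of `L²(D; H)` with `H = L²(Ω)`, and let `A : H → L²(D)` send `h` to
`⟪h, f ·⟫`. Then `T_Φ = A A†`, which has the same nonzero eigenvalues, with multiplicity, as the
compact self-adjoint operator `A† A` on `H`. If `b` is a Hilbert basis of eigenvectors of `A† A`,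
the eigenvalue at `b i` is `‖A (b i)‖² = ∫ ⟪b i, f⟫² ≥ 0`, and integrating Parseval's identity for
`f y` shows that these sum to `∫ ‖f‖²`. Any admissible list agrees with this family off the zeros,
so it has the same sum and comes from orthogonal vectors `g k`, each a unit vector or zero. Put `Ξ_k
= g k` and `Ψ_k(y) = ⟪g k, Φ(y, ·)⟫` for `k < N`. Then `Ψ(y) · Ξ` is the projection of `Φ(y, ·)`
onto the span of these `g k`, and Pythagoras integrated over `D` leaves the tail of the series.
Diagonalizing on the `Ω` side makes `Ψ` continuous, since `y ↦ Φ(y, ·)` is continuous into `H`. -/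

/-! ### The operator `A` and its compactness. -/

section CompLp

variable {X H : Type*} [MeasurableSpace X] {μ : Measure X} [NormedAddCommGroup H]
  [InnerProductSpace ℝ H]

/-- The map `(f, h) ↦ ⟪h, f ·⟫` from `L²(μ; H) × H` to `L²(μ)`, as a bounded bilinear map. -/
noncomputable def innerCompLp (μ : Measure X) (H : Type*) [NormedAddCommGroup H]
    [InnerProductSpace ℝ H] : Lp H 2 μ →L[ℝ] H →L[ℝ] Lp ℝ 2 μ :=
  LinearMap.mkContinuous₂
    (LinearMap.mk₂ ℝ (fun (f : Lp H 2 μ) (h : H) => (innerSL ℝ h).compLpₗ 2 μ f)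
      (fun f g h => map_add ((innerSL ℝ h).compLpₗ 2 μ) f g)
      (fun c f h => map_smul ((innerSL ℝ h).compLpₗ 2 μ) c f)
      (fun f h h' => by
        rw [map_add]
        exact ContinuousLinearMap.add_compLp _ _ f)
      (fun c f h => by
        rw [map_smul]
        exact ContinuousLinearMap.smul_compLp c _ f)) 1
    (fun f h => by
      rw [one_mul, mul_comm]
      exact (ContinuousLinearMap.norm_compLp_le (innerSL ℝ h) f).trans_eq
        (by rw [innerSL_apply_norm]))

theorem coeFn_innerCompLp (f : Lp H 2 μ) (h : H) :
    innerCompLp μ H f h =ᵐ[μ] fun x => inner ℝ h (f x) :=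
  ContinuousLinearMap.coeFn_compLp (innerSL ℝ h) f

/-- An indicator function with a constant vector value gives a rank-one operator. Sums preserve
compactness, and so do limits, because the operator depends continuously on `f` and compact
operators are norm-closed. -/
theorem isCompactOperator_innerCompLp (f : Lp H 2 μ) :
    IsCompactOperator (innerCompLp μ H f) := by
  refine Lp.induction (by norm_num) (motive := fun f => IsCompactOperator (innerCompLp μ H f))
    ?_ ?_ ?_ f
  · intro c s hs hμs
    have : innerCompLp μ H (Lp.simpleFunc.indicatorConst 2 hs hμs.ne c : Lp H 2 μ) =
        (ContinuousLinearMap.toSpanSingleton ℝ (indicatorConstLp 2 hs hμs.ne (1 : ℝ))).comp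
          (innerSL ℝ c) := by
      ext1 h
      refine Lp.ext ?_
      rw [Lp.simpleFunc.coe_indicatorConst]
      simp only [ContinuousLinearMap.comp_apply, ContinuousLinearMap.toSpanSingleton_apply,
        innerSL_apply_apply]
      filter_upwards [coeFn_innerCompLp (indicatorConstLp 2 hs hμs.ne c) h,
        indicatorConstLp_coeFn (p := 2) (hs := hs) (hμs := hμs.ne) (c := c),
        Lp.coeFn_smul (inner ℝ c h) (indicatorConstLp 2 hs hμs.ne (1 : ℝ)),
        indicatorConstLp_coeFn (p := 2) (hs := hs) (hμs := hμs.ne) (c := (1 : ℝ))]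
        with x h1 h2 h3 h4
      rw [h1, h2, h3, Pi.smul_apply, h4]
      by_cases hx : x ∈ s <;> simp [hx, real_inner_comm]
    rw [this, ContinuousLinearMap.coe_comp]
    exact (isCompactOperator_of_locallyCompactSpace_rng
      (ContinuousLinearMap.toSpanSingleton ℝ (indicatorConstLp 2 hs hμs.ne (1 : ℝ)))).comp_clm (innerSL ℝ c)
  · intro f g hf hg _ h1 h2
    rw [map_add]
    exact h1.add h2
  · exact (isClosed_setOfPred_isCompactOperator (σ₁₂ := RingHom.id ℝ)
      (M₁ := H) (M₂ := Lp ℝ 2 μ)).preimage (innerCompLp μ H).continuous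

end CompLp

/-! ### Spectral theory: eigenbases, multiplicities, and `R S` against `S R`. -/

section Spectral

open Module.End ContinuousLinearMap

universe u

variable {E : Type u} [NormedAddCommGroup E] [InnerProductSpace ℝ E] [CompleteSpace E]

/-- A compact self-adjoint operator has a Hilbert basis of eigenvectors. -/
theorem exists_hilbertBasis_eigenvectors {T : E →L[ℝ] E} (hT : IsCompactOperator T)
    (hT' : T.IsSymmetric) :
    ∃ (ι : Type u) (b : HilbertBasis ι ℝ E) (ev : ι → ℝ), ∀ i, T (b i) = ev i • b i := by
  let V : ℝ → Submodule ℝ E := fun c => eigenspace (T : Module.End ℝ E) c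
  have hV : OrthogonalFamily ℝ (fun c => V c) fun c => (V c).subtypeₗᵢ :=
    hT'.orthogonalFamily_eigenspaces
  have hcompl (c : ℝ) : CompleteSpace (V c) := by
    have : IsClosed ((V c : Submodule ℝ E) : Set E) := by
      have : ((V c : Submodule ℝ E) : Set E) = {x | T x = c • x} := by
        ext x; simp [V]
      rw [this]
      exact isClosed_eq T.continuous (continuous_const_smul c)
    exact this.completeSpace_coe
  choose w b hb using fun c => exists_hilbertBasis ℝ (V c)
  have hon := hV.orthonormal_sigma_orthonormal (v_family := fun c => b c)
    fun c => (b c).orthonormal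
  let v : (Σ c, w c) → E := fun a => (V a.1).subtypeₗᵢ (b a.1 a.2)
  -- By the spectral theorem it suffices that every eigenspace lies in the closure of the span;
  -- expansion in its own Hilbert basis gives this.
  have hbot : (Submodule.span ℝ (Set.range v))ᗮ = ⊥ := by
    rw [eq_bot_iff, ← orthogonalComplement_iSup_eigenspaces_eq_bot hT hT',
      ← Submodule.orthogonal_closure (Submodule.span ℝ (Set.range v))]
    refine Submodule.orthogonal_le (iSup_le fun c x hx => ?_)
    have h := (b c).hasSum_repr ⟨x, hx⟩
    refine mem_closure_of_tendsto (h.mapL (V c).subtypeL) (Eventually.of_forall fun s => ?_)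
    refine Submodule.sum_mem _ fun i _ => ?_
    rw [map_smul]
    exact Submodule.smul_mem _ _ (Submodule.subset_span ⟨⟨c, i⟩, rfl⟩)
  refine ⟨_, HilbertBasis.mkOfOrthogonalEqBot hon hbot, fun a => a.1, fun a => ?_⟩
  rw [HilbertBasis.coe_mkOfOrthogonalEqBot]
  exact mem_eigenspace_iff.1 (b a.1 a.2).2

/-- By symmetry, an eigenvector for `c` has zero coefficient along each `b i` with another
eigenvalue, so the remaining `b i` span the eigenspace. For `c ≠ 0` compactness makes them finitely
many, so the expansion is a finite sum. -/
theorem mk_eq_rank_eigenspace {T : E →L[ℝ] E} (hT : IsCompactOperator T)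
    {ι : Type u} (b : HilbertBasis ι ℝ E) {ev : ι → ℝ} (hb : ∀ i, T (b i) = ev i • b i)
    (hT' : T.IsSymmetric) {c : ℝ} (hc : c ≠ 0) :
    Cardinal.mk {i // ev i = c} = Module.rank ℝ (eigenspace (T : Module.End ℝ E) c) := by
  have hfin : FiniteDimensional ℝ (eigenspace (T : Module.End ℝ E) c) :=
    finite_dimensional_eigenspace hT c hc
  let v : {i // ev i = c} → eigenspace (T : Module.End ℝ E) c := fun i =>
    ⟨b i, mem_eigenspace_iff.2 (by rw [ContinuousLinearMap.coe_coe, hb, i.2])⟩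
  have hli : LinearIndependent ℝ v := by
    refine LinearIndependent.of_comp (Submodule.subtype _) ?_
    exact b.orthonormal.linearIndependent.comp _ Subtype.val_injective
  have : Finite {i // ev i = c} := hli.finite_of_isNoetherian
  have : Fintype {i // ev i = c} := Fintype.ofFinite _
  have hsp : ⊤ ≤ Submodule.span ℝ (Set.range v) := by
    rintro ⟨x, hx⟩ -
    have hx' : T x = c • x := mem_eigenspace_iff.1 hx
    have hz (i : ι) (hi : ev i ≠ c) : b.repr x i = 0 := by
      rw [b.repr_apply_apply]
      have h1 := hT' (b i) x
      simp only [ContinuousLinearMap.coe_coe, hb, hx', inner_smul_left, inner_smul_right] at h1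
      have : (ev i - c) * inner ℝ (b i) x = 0 := by
        rw [sub_mul]; simpa [sub_eq_zero] using h1
      exact (mul_eq_zero.1 this).resolve_left (sub_ne_zero.2 hi)
    have hs := b.hasSum_repr x
    have hs' : HasSum (fun i : {i // ev i = c} => b.repr x i • b i) x :=
      (Subtype.val_injective.hasSum_iff fun i hi => by
        rw [hz i fun h => hi ⟨⟨i, h⟩, rfl⟩, zero_smul]).2 hs
    have hxs : (⟨x, hx⟩ : eigenspace (T : Module.End ℝ E) c) =
        ∑ i : {i // ev i = c}, b.repr x i • v i := by
      ext
      simpa [v] using hs'.unique (hasSum_fintype _)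
    rw [hxs]
    exact Submodule.sum_mem _ fun i _ => Submodule.smul_mem _ _ (Submodule.subset_span ⟨i, rfl⟩)
  exact (Module.Basis.mk hli hsp).mk_eq_rank''

/-- For `c ≠ 0`, the maps `S ∘ R` and `R ∘ S` have isomorphic eigenspaces. -/
noncomputable def eigenspaceCompEquiv {V W : Type*} [AddCommGroup V] [Module ℝ V]
    [AddCommGroup W] [Module ℝ W] (R : V →ₗ[ℝ] W) (S : W →ₗ[ℝ] V) {c : ℝ} (hc : c ≠ 0) :
    eigenspace (S ∘ₗ R : Module.End ℝ V) c ≃ₗ[ℝ] eigenspace (R ∘ₗ S : Module.End ℝ W) c :=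
  LinearEquiv.ofLinearMap
    ((R.domRestrict _).codRestrict _ fun x => mem_eigenspace_iff.2 (by
      have := mem_eigenspace_iff.1 x.2
      simp only [LinearMap.comp_apply, LinearMap.domRestrict_apply] at this ⊢
      rw [this, map_smul]))
    -- `S R` and `R S` act as `c` on these eigenspaces, so `c⁻¹ S` inverts `R`.
    (c⁻¹ • (S.domRestrict _).codRestrict _ fun x => mem_eigenspace_iff.2 (by
      have := mem_eigenspace_iff.1 x.2
      simp only [LinearMap.comp_apply, LinearMap.domRestrict_apply] at this ⊢
      rw [this, map_smul]))
    (by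
      ext x
      have := mem_eigenspace_iff.1 x.2
      simp only [LinearMap.comp_apply] at this
      simp [this, hc])
    (by
      ext x
      have := mem_eigenspace_iff.1 x.2
      simp only [LinearMap.comp_apply] at this
      simp [this, hc])

end Spectral

/-! ### Matching two families by their nonzero values. -/

section Reindex

/-- The bijections between fibres over each nonzero value glue together; the fibres over `0` may
differ in size. -/
theorem exists_equiv_of_fibers {α β : Type*} {u : α → ℝ} {v : β → ℝ}
    (h : ∀ c : ℝ, c ≠ 0 → Nonempty ({a // u a = c} ≃ {b // v b = c})) :
    ∃ σ : {a // u a ≠ 0} ≃ {b // v b ≠ 0}, ∀ a, v (σ a) = u a := by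
  let e (c : {c : ℝ // c ≠ 0}) : {a : {a // u a ≠ 0} // (⟨u a, a.2⟩ : {c : ℝ // c ≠ 0}) = c} ≃
      {b : {b // v b ≠ 0} // (⟨v b, b.2⟩ : {c : ℝ // c ≠ 0}) = c} :=
    let e1 : {a : {a // u a ≠ 0} // (⟨u a, a.2⟩ : {c : ℝ // c ≠ 0}) = c} ≃ {a // u a = c} :=
      { toFun := fun a => ⟨a.1, congrArg Subtype.val a.2⟩
        invFun := fun a => ⟨⟨a.1, a.2.symm ▸ c.2⟩, Subtype.ext a.2⟩
        left_inv := fun _ => rfl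
        right_inv := fun _ => rfl }
    let e2 : {b : {b // v b ≠ 0} // (⟨v b, b.2⟩ : {c : ℝ // c ≠ 0}) = c} ≃ {b // v b = c} :=
      { toFun := fun a => ⟨a.1, congrArg Subtype.val a.2⟩
        invFun := fun a => ⟨⟨a.1, a.2.symm ▸ c.2⟩, Subtype.ext a.2⟩
        left_inv := fun _ => rfl
        right_inv := fun _ => rfl }
    (e1.trans (h c c.2).some).trans e2.symm
  exact ⟨Equiv.ofFiberEquiv e, fun a => congrArg Subtype.val (Equiv.ofFiberEquiv_map e a)⟩

/-- Embed `ι` in `ℕ` and pad with zeros, which meet no fibre over `c ≠ 0`. -/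
theorem exists_seq_equiv_fibers {ι : Type*} [Countable ι] (v : ι → ℝ) :
    ∃ u : ℕ → ℝ, ∀ c : ℝ, c ≠ 0 → Nonempty ({k // u k = c} ≃ {i // v i = c}) := by
  obtain ⟨e, he⟩ := exists_injective_nat ι
  refine ⟨Function.extend e v 0, fun c hc => ⟨(Equiv.ofBijective (fun i : {i // v i = c} =>
    (⟨e i, by rw [he.extend_apply, i.2]⟩ : {k // Function.extend e v 0 k = c})) ⟨?_, ?_⟩).symm⟩⟩
  · exact fun i j hij => Subtype.ext (he (congrArg Subtype.val hij))
  · rintro ⟨k, hk⟩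
    by_cases hr : ∃ i, e i = k
    · obtain ⟨i, rfl⟩ := hr
      exact ⟨⟨i, by rwa [he.extend_apply] at hk⟩, rfl⟩
    · rw [Function.extend_apply' _ _ _ hr] at hk
      exact absurd hk.symm hc

end Reindex

section Countable

/-- Orthonormal vectors are `√2` apart, so balls of radius `1 / 2` around them are disjoint, and
separability allows only countably many. -/
theorem Orthonormal.countable {ι E : Type*} [NormedAddCommGroup E] [InnerProductSpace ℝ E]
    [TopologicalSpace.SeparableSpace E] {v : ι → E} (hv : Orthonormal ℝ v) : Countable ι := by
  have hd (i j : ι) (hij : i ≠ j) : 1 < dist (v i) (v j) := by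
    have h := norm_sub_sq_real (v i) (v j)
    rw [hv.1, hv.1, hv.2 hij] at h
    rw [dist_eq_norm]
    nlinarith [norm_nonneg (v i - v j)]
  refine Pairwise.countable_of_isOpen_disjoint (s := fun i => Metric.ball (v i) (1 / 2)) ?_
    (fun _ => Metric.isOpen_ball) fun i => Metric.nonempty_ball.2 (by norm_num)
  exact fun i j hij => Metric.ball_disjoint_ball (by linarith [hd i j hij])

end Countable

/-! ### The trace identity and the eigenvalue sequences. -/

section Trace

variable {X H : Type} [MeasurableSpace X] {μ : Measure X} [NormedAddCommGroup H]
  [InnerProductSpace ℝ H]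

theorem norm_innerCompLp_sq (f : Lp H 2 μ) (h : H) :
    ‖innerCompLp μ H f h‖ ^ 2 = ∫ x, inner ℝ h (f x) ^ 2 ∂μ := by
  rw [← real_inner_self_eq_norm_sq, L2.inner_def]
  refine integral_congr_ae ?_
  filter_upwards [coeFn_innerCompLp f h] with x hx
  rw [hx, real_inner_self_eq_norm_sq, Real.norm_eq_abs, sq_abs]

theorem integrable_inner_sq (f : Lp H 2 μ) (h : H) :
    Integrable (fun x => inner ℝ h (f x) ^ 2) μ :=
  ((Lp.memLp f).const_inner h).integrable_sq

/-- Parseval for each `f x`, integrated termwise: the nonnegative terms have the integrable sum `‖f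
x‖²`. Separability makes the basis countable, as the interchange requires. -/
theorem hasSum_norm_innerCompLp_sq [CompleteSpace H] [TopologicalSpace.SeparableSpace H]
    (f : Lp H 2 μ) {ι : Type} (b : HilbertBasis ι ℝ H) :
    HasSum (fun i => ‖innerCompLp μ H f (b i)‖ ^ 2) (∫ x, ‖f x‖ ^ 2 ∂μ) := by
  have := b.orthonormal.countable
  have hs (v : H) : HasSum (fun i => inner ℝ (b i) v ^ 2) (‖v‖ ^ 2) := by
    simpa only [real_inner_self_eq_norm_sq, real_inner_comm, ← sq] using
      b.hasSum_inner_mul_inner v v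
  have hint : Integrable (fun x => ‖f x‖ ^ 2) μ := (Lp.memLp f).integrable_norm_pow (by norm_num)
  simp only [norm_innerCompLp_sq]
  refine hasSum_integral_of_dominated_convergence (fun i x => inner ℝ (b i) (f x) ^ 2)
    (fun i => (integrable_inner_sq f (b i)).aestronglyMeasurable) ?_ ?_ ?_ ?_
  · exact fun i => Eventually.of_forall fun x => (Real.norm_of_nonneg (sq_nonneg _)).le
  · exact Eventually.of_forall fun x => (hs (f x)).summable
  · simpa only [(hs _).tsum_eq] using hint
  · exact Eventually.of_forall fun x => hs (f x)

/-- Pythagoras for a projection. Zero vectors are admitted because zero entries of an eigenvalue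
list contribute them. -/
theorem norm_sub_sum_inner_smul_sq {κ : Type*} [Fintype κ] {g : κ → H}
    (hg : Pairwise fun j k => inner ℝ (g j) (g k) = 0) (hg1 : ∀ k, g k ≠ 0 → ‖g k‖ = 1) (x : H) :
    ‖x - ∑ k, inner ℝ (g k) x • g k‖ ^ 2 = ‖x‖ ^ 2 - ∑ k, inner ℝ (g k) x ^ 2 := by
  classical
  have h1 : inner ℝ x (∑ k, inner ℝ (g k) x • g k) = ∑ k, inner ℝ (g k) x ^ 2 := by
    rw [inner_sum]
    exact Finset.sum_congr rfl fun k _ => by rw [inner_smul_right, real_inner_comm, sq]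
  have h2 (k : κ) : inner ℝ (g k) (∑ j, inner ℝ (g j) x • g j) = inner ℝ (g k) x := by
    rw [inner_sum, Finset.sum_eq_single k]
    · rw [inner_smul_right, real_inner_self_eq_norm_sq]
      by_cases hk : g k = 0
      · simp [hk]
      · rw [hg1 k hk]; ring
    · exact fun j _ hj => by rw [inner_smul_right, hg hj.symm, mul_zero]
    · simp
  have h3 : ‖∑ k, inner ℝ (g k) x • g k‖ ^ 2 = ∑ k, inner ℝ (g k) x ^ 2 := by
    rw [← real_inner_self_eq_norm_sq]
    nth_rewrite 1 [sum_inner]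
    refine Finset.sum_congr rfl fun k _ => ?_
    rw [real_inner_smul_left, h2, sq]
  rw [norm_sub_sq_real, h1, h3]
  ring

open ContinuousLinearMap in
/-- For `A = innerCompLp μ H f`, the eigenvalues of `A A†` can be listed in a sequence; every such
sequence has sum `∫ ‖f‖²` and comes from an orthogonal sequence of eigenvectors of `A† A`, normalized
or zero. -/
theorem isEigenvalueSequence_innerCompLp [CompleteSpace H] [TopologicalSpace.SeparableSpace H]
    (f : Lp H 2 μ) (T : Lp ℝ 2 μ →ₗ[ℝ] Lp ℝ 2 μ)
    (hT : ∀ φ, T φ = innerCompLp μ H f (adjoint (innerCompLp μ H f) φ)) :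
    (∃ ev : ℕ → ℝ, IsEigenvalueSequence T ev) ∧
    ∀ ev : ℕ → ℝ, IsEigenvalueSequence T ev →
      HasSum ev (∫ x, ‖f x‖ ^ 2 ∂μ) ∧
      ∃ g : ℕ → H, (Pairwise fun j k => inner ℝ (g j) (g k) = 0) ∧ (∀ k, g k ≠ 0 → ‖g k‖ = 1) ∧
        ∀ k, ev k = ∫ x, inner ℝ (g k) (f x) ^ 2 ∂μ := by
  set A := innerCompLp μ H f with hA
  let S : H →L[ℝ] H := (adjoint A).comp A
  have hS : IsCompactOperator S := (isCompactOperator_innerCompLp f).clm_comp (adjoint A)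
  have hS' : S.IsSymmetric := fun x y => by
    simp only [S, coe_coe, comp_apply, adjoint_inner_left, adjoint_inner_right]
  obtain ⟨ι, b, v, hb⟩ := exists_hilbertBasis_eigenvectors hS hS'
  have := b.orthonormal.countable
  have hv (i : ι) : v i = ‖A (b i)‖ ^ 2 := by
    have h1 : inner ℝ (b i) (S (b i)) = v i := by
      rw [hb, inner_smul_right, real_inner_self_eq_norm_sq, b.orthonormal.1 i]; ring
    rw [← h1, comp_apply, adjoint_inner_right, real_inner_self_eq_norm_sq]
  have hrank (c : ℝ) (hc : c ≠ 0) :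
      Module.rank ℝ (Module.End.eigenspace T c) = Cardinal.mk {i // v i = c} := by
    rw [mk_eq_rank_eigenspace hS b hb hS' hc,
      show T = A.toLinearMap ∘ₗ (adjoint A).toLinearMap from LinearMap.ext hT]
    exact (eigenspaceCompEquiv A.toLinearMap (adjoint A).toLinearMap hc).symm.rank_eq
  have hiff (ev : ℕ → ℝ) : IsEigenvalueSequence T ev ↔
      ∀ c : ℝ, c ≠ 0 → Nonempty ({k // ev k = c} ≃ {i // v i = c}) :=
    forall₂_congr fun c hc => by rw [hrank c hc, Cardinal.eq]
  refine ⟨?_, fun ev hev => ?_⟩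
  · obtain ⟨ev, hev⟩ := exists_seq_equiv_fibers v
    exact ⟨ev, (hiff ev).2 hev⟩
  obtain ⟨σ, hσ⟩ := exists_equiv_of_fibers ((hiff ev).1 hev)
  constructor
  · have h1 : HasSum v (∫ x, ‖f x‖ ^ 2 ∂μ) := by
      rw [funext hv]
      exact hasSum_norm_innerCompLp_sq f b
    -- Zero terms do not affect the sum, so it passes through the bijection `σ` of nonzero entries.
    have h2 : HasSum (fun i : {i // v i ≠ 0} => v i) (∫ x, ‖f x‖ ^ 2 ∂μ) :=
      (hasSum_subtype_iff_of_support_subset (s := {i | v i ≠ 0}) (fun i hi => hi)).2 h1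
    refine (hasSum_subtype_iff_of_support_subset (s := {k | ev k ≠ 0}) (fun k hk => hk)).1 ?_
    convert! σ.hasSum_iff.2 h2 using 1
    exact funext fun k => (hσ k).symm
  -- A list may contain more zeros than the kernel of `S` has dimensions, so zero entries get the
  -- zero vector.
  · let g (k : ℕ) : H := if h : ev k ≠ 0 then b (σ ⟨k, h⟩) else 0
    have hg {k : ℕ} (h : ev k ≠ 0) : g k = b (σ ⟨k, h⟩) := dif_pos h
    have hg0 {k : ℕ} (h : ev k = 0) : g k = 0 := dif_neg (not_not.2 h)
    refine ⟨g, fun j k hjk => ?_, fun k hk => ?_, fun k => ?_⟩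
    · change inner ℝ (g j) (g k) = 0
      by_cases hj : ev j = 0
      · rw [hg0 hj, inner_zero_left]
      by_cases hk : ev k = 0
      · rw [hg0 hk, inner_zero_right]
      rw [hg hj, hg hk]
      refine b.orthonormal.2 fun h => hjk ?_
      exact congrArg Subtype.val (σ.injective (Subtype.ext h))
    · by_cases h : ev k = 0
      · exact absurd (hg0 h) hk
      · rw [hg h, b.orthonormal.1]
    · rw [← norm_innerCompLp_sq]
      by_cases h : ev k = 0
      · simp [hg0 h, h]
      · rw [hg h, ← hA, ← hv, hσ ⟨k, h⟩]

end Trace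

/-! ### The sections `Φ(y, ·)` and the factorization of `T_Φ`. -/

section Sections

variable {n m : ℕ} {D : Set (EuclideanSpace ℝ (Fin n))} {Ω : Set (EuclideanSpace ℝ (Fin m))}
  {Φ : EuclideanSpace ℝ (Fin n) → EuclideanSpace ℝ (Fin m) → ℝ}

open Classical in
/-- The map `y ↦ Φ(y, ·)` into `L²(Ω)`, extended by zero outside the closure of `D`. -/
noncomputable def MemCL2.section (hΦ : MemCL2 D Ω Φ) (y : EuclideanSpace ℝ (Fin n)) :
    Lp ℝ 2 (volume.restrict Ω) :=
  if hy : y ∈ closure D then (hΦ.memLp y hy).toLp else 0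

theorem MemCL2.coeFn_section (hΦ : MemCL2 D Ω Φ) {y : EuclideanSpace ℝ (Fin n)}
    (hy : y ∈ closure D) : hΦ.section y =ᵐ[volume.restrict Ω] Φ y := by
  rw [MemCL2.section, dif_pos hy]
  exact (hΦ.memLp y hy).coeFn_toLp

theorem MemCL2.continuousOn_section (hΦ : MemCL2 D Ω Φ) : ContinuousOn hΦ.section (closure D) := by
  intro y hy
  rw [ContinuousWithinAt, Lp.tendsto_Lp_iff_tendsto_eLpNorm']
  refine (hΦ.tendsto y hy).congr' ?_
  filter_upwards [self_mem_nhdsWithin] with z hz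
  exact eLpNorm_congr_ae ((hΦ.coeFn_section hz).sub (hΦ.coeFn_section hy)).symm

theorem MemCL2.inner_section (hΦ : MemCL2 D Ω Φ) {y z : EuclideanSpace ℝ (Fin n)}
    (hy : y ∈ closure D) (hz : z ∈ closure D) :
    inner ℝ (hΦ.section y) (hΦ.section z) = mercerKernel Ω Φ y z := by
  rw [L2.inner_def]
  refine integral_congr_ae ?_
  filter_upwards [hΦ.coeFn_section hy, hΦ.coeFn_section hz] with x h1 h2
  rw [h1, h2, real_inner_eq_re_inner, RCLike.inner_apply, mul_comm]
  simp

theorem MemCL2.memLp_section (hΦ : MemCL2 D Ω Φ) (hD : IsOpen D) (hDb : Bornology.IsBounded D) :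
    MemLp hΦ.section 2 (volume.restrict D) := by
  have : IsFiniteMeasure (volume.restrict D) :=
    isFiniteMeasure_restrict.2 hDb.measure_lt_top.ne
  obtain ⟨C, hC⟩ := hDb.isCompact_closure.exists_bound_of_continuousOn hΦ.continuousOn_section
  refine MemLp.of_bound
    ((hΦ.continuousOn_section.mono subset_closure).aestronglyMeasurable hD.measurableSet) C ?_
  filter_upwards [ae_restrict_mem hD.measurableSet] with y hy using hC y (subset_closure hy)

open ContinuousLinearMap in
-- For almost every `y`, `(A A† φ)(y) = ⟪A† φ, f y⟫ = ⟪φ, A (f y)⟫ = ∫ φ(z) ⟪f y, f z⟫ dz`, and `⟪f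
-- y, f z⟫` is the kernel; no formula for `A†` is needed.
theorem MemCL2.mercerOperator_eq (hΦ : MemCL2 D Ω Φ) (hD : IsOpen D) (hDb : Bornology.IsBounded D)
    {f : Lp (Lp ℝ 2 (volume.restrict Ω)) 2 (volume.restrict D)}
    (hf : f =ᵐ[volume.restrict D] hΦ.section) (φ : Lp ℝ 2 (volume.restrict D)) :
    mercerOperator hΦ hD hDb φ = innerCompLp _ _ f (adjoint (innerCompLp _ _ f) φ) := by
  refine Lp.ext ?_
  filter_upwards [ae_restrict_mem hD.measurableSet, hf,
    coeFn_innerCompLp f (adjoint (innerCompLp _ _ f) φ),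
    (hΦ.memLp_integral hD hDb φ).coeFn_toLp] with y hy h1 h2 h3
  rw [h2, h1, adjoint_inner_left, L2.inner_def]
  refine Eq.trans h3 (integral_congr_ae ?_)
  filter_upwards [ae_restrict_mem hD.measurableSet, hf,
    coeFn_innerCompLp f (hΦ.section y)] with z hz h4 h5
  rw [h5, h4, hΦ.inner_section (subset_closure hy) (subset_closure hz)]
  simp

theorem enorm_sq_eq_lintegral {X : Type*} [MeasurableSpace X] {μ : Measure X} (u : Lp ℝ 2 μ) :
    ‖u‖ₑ ^ 2 = ∫⁻ x, ‖u x‖ₑ ^ 2 ∂μ := by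
  rw [Lp.enorm_def]
  simpa using eLpNorm_nnreal_pow_eq_lintegral (f := u) (μ := μ) (p := 2) (by norm_num)

/-- Tonelli: the norm on the product is computed section by section. -/
theorem eLpNorm_two_sq_eq_ofReal {X Y : Type*} [MeasurableSpace X] [MeasurableSpace Y]
    {μ : Measure X} {ν : Measure Y} [SFinite ν] {G : X × Y → ℝ}
    (hG : AEStronglyMeasurable G (μ.prod ν)) {u : X → Lp ℝ 2 ν}
    (hu : ∀ᵐ x ∂μ, (fun y => G (x, y)) =ᵐ[ν] u x) (hi : Integrable (fun x => ‖u x‖ ^ 2) μ) :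
    eLpNorm G 2 (μ.prod ν) ^ 2 = ENNReal.ofReal (∫ x, ‖u x‖ ^ 2 ∂μ) := by
  have h := eLpNorm_nnreal_pow_eq_lintegral (f := G) (μ := μ.prod ν) (p := 2) (by norm_num)
  simp only [NNReal.coe_ofNat, ENNReal.rpow_ofNat, ENNReal.coe_ofNat] at h
  rw [h, lintegral_prod _ (hG.enorm.pow_const 2), ofReal_integral_eq_lintegral_ofReal hi
    (Eventually.of_forall fun x => sq_nonneg _)]
  refine lintegral_congr_ae ?_
  filter_upwards [hu] with x hx
  rw [ENNReal.ofReal_pow (norm_nonneg _), ofReal_norm, enorm_sq_eq_lintegral]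
  refine lintegral_congr_ae ?_
  filter_upwards [hx] with y hy
  rw [hy]

end Sections

theorem lemma3p7 {n m : ℕ} (D : Set (EuclideanSpace ℝ (Fin n)))
    (Ω : Set (EuclideanSpace ℝ (Fin m)))
    (hD : IsOpen D) (hDb : Bornology.IsBounded D)
    (hΩ : IsOpen Ω) (hΩb : Bornology.IsBounded Ω)
    (Φ : EuclideanSpace ℝ (Fin n) → EuclideanSpace ℝ (Fin m) → ℝ)
    (hΦ : MemCL2 D Ω Φ) :
    (∃ ev : ℕ → ℝ, IsEigenvalueSequence (mercerOperator hΦ hD hDb) ev) ∧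
    ∀ ev : ℕ → ℝ, IsEigenvalueSequence (mercerOperator hΦ hD hDb) ev →
      (∀ k, 0 ≤ ev k) ∧
      ∀ N : ℕ, ∃ (Ψ : EuclideanSpace ℝ (Fin n) → EuclideanSpace ℝ (Fin N))
        (Ξ : EuclideanSpace ℝ (Fin m) → EuclideanSpace ℝ (Fin N)),
        ContinuousOn Ψ (closure D) ∧
        MemLp Ξ 2 (volume.restrict Ω) ∧
        MemLp (fun p : EuclideanSpace ℝ (Fin n) × EuclideanSpace ℝ (Fin m) =>
          Φ p.1 p.2 - inner ℝ (Ψ p.1) (Ξ p.2)) 2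
          ((volume.restrict D).prod (volume.restrict Ω)) ∧
        HasSum (fun k : ℕ => ev (N + k))
          ((eLpNorm (fun p : EuclideanSpace ℝ (Fin n) × EuclideanSpace ℝ (Fin m) =>
            Φ p.1 p.2 - inner ℝ (Ψ p.1) (Ξ p.2)) 2
            ((volume.restrict D).prod (volume.restrict Ω))).toReal ^ 2) := by
  obtain ⟨f, hf⟩ : ∃ f : Lp (Lp ℝ 2 (volume.restrict Ω)) 2 (volume.restrict D),
      f =ᵐ[volume.restrict D] hΦ.section := ⟨_, (hΦ.memLp_section hD hDb).coeFn_toLp⟩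
  -- Lets instance search find that `L²(Ω)` is separable.
  have : Fact ((2 : ENNReal) ≠ ⊤) := ⟨by norm_num⟩
  obtain ⟨hex, hall⟩ := isEigenvalueSequence_innerCompLp f (mercerOperator hΦ hD hDb)
    (hΦ.mercerOperator_eq hD hDb hf)
  refine ⟨hex, fun ev hev => ?_⟩
  obtain ⟨hsum, g, horth, hnorm, hg⟩ := hall ev hev
  refine ⟨fun k => hg k ▸ integral_nonneg fun x => sq_nonneg _, fun N => ?_⟩
  let Ψ : EuclideanSpace ℝ (Fin n) → EuclideanSpace ℝ (Fin N) := fun y =>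
    WithLp.toLp 2 fun k => inner ℝ (g k) (hΦ.section y)
  let Ξ : EuclideanSpace ℝ (Fin m) → EuclideanSpace ℝ (Fin N) := fun x =>
    WithLp.toLp 2 fun k => g k x
  -- The residual of the projection of `Φ(y, ·)`, as an element of `L²(Ω)`.
  let u : EuclideanSpace ℝ (Fin n) → Lp ℝ 2 (volume.restrict Ω) := fun y =>
    hΦ.section y - ∑ k : Fin N, inner ℝ (g k) (hΦ.section y) • g k
  have hΨ : ContinuousOn Ψ (closure D) := by
    refine (PiLp.continuous_toLp 2 _).comp_continuousOn (continuousOn_pi.2 fun k => ?_)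
    exact continuousOn_const.inner hΦ.continuousOn_section
  have hΞ : MemLp Ξ 2 (volume.restrict Ω) := memLp_piLp_iff.2 fun k => Lp.memLp (g k)
  have hmeas : AEStronglyMeasurable
      (fun p : EuclideanSpace ℝ (Fin n) × EuclideanSpace ℝ (Fin m) =>
        Φ p.1 p.2 - inner ℝ (Ψ p.1) (Ξ p.2)) ((volume.restrict D).prod (volume.restrict Ω)) := by
    refine AEStronglyMeasurable.sub ?_ (AEStronglyMeasurable.inner ?_ ?_)
    · exact hΦ.aestronglyMeasurable.mono_measure
        (Measure.prod_mono (Measure.restrict_mono subset_closure le_rfl) le_rfl)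
    · exact ((hΨ.mono subset_closure).aestronglyMeasurable hD.measurableSet).comp_fst
    · exact hΞ.1.comp_snd
  have hu : ∀ᵐ y ∂volume.restrict D,
      (fun x => Φ y x - inner ℝ (Ψ y) (Ξ x)) =ᵐ[volume.restrict Ω] u y := by
    filter_upwards [ae_restrict_mem hD.measurableSet] with y hy
    have hk : ∀ᵐ x ∂volume.restrict Ω, ∀ k : Fin N,
        (inner ℝ (g k) (hΦ.section y) • g k : Lp ℝ 2 (volume.restrict Ω)) x =
          inner ℝ (g k) (hΦ.section y) * g k x :=
      ae_all_iff.2 fun k => Lp.coeFn_smul _ (g k)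
    filter_upwards [hΦ.coeFn_section (subset_closure hy), Lp.coeFn_sub (hΦ.section y)
      (∑ k : Fin N, inner ℝ (g k) (hΦ.section y) • g k),
      Lp.coeFn_finsetSum Finset.univ fun k : Fin N => inner ℝ (g k) (hΦ.section y) • g k, hk]
      with x h1 h2 h3 h4
    rw [h2, Pi.sub_apply, h1, h3, Finset.sum_apply, PiLp.inner_apply]
    simp [h4, Ψ, Ξ, mul_comm]
  have husq (y : EuclideanSpace ℝ (Fin n)) :
      ‖u y‖ ^ 2 = ‖hΦ.section y‖ ^ 2 - ∑ k : Fin N, inner ℝ (g k) (hΦ.section y) ^ 2 :=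
    norm_sub_sum_inner_smul_sq (g := fun k : Fin N => g k)
      (fun j k hjk => horth (Fin.val_injective.ne hjk)) (fun k => hnorm k) _
  have hfu : (fun y => ‖f y‖ ^ 2 - ∑ k : Fin N, inner ℝ (g k) (f y) ^ 2) =ᵐ[volume.restrict D]
      fun y => ‖u y‖ ^ 2 := by
    filter_upwards [hf] with y hy
    rw [husq, hy]
  have hint1 : Integrable (fun y => ‖f y‖ ^ 2) (volume.restrict D) :=
    (Lp.memLp f).integrable_norm_pow (by norm_num)
  have hint2 : Integrable (fun y => ∑ k : Fin N, inner ℝ (g k) (f y) ^ 2) (volume.restrict D) :=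
    integrable_finsetSum _ fun k _ => integrable_inner_sq f (g k)
  have hint : Integrable (fun y => ‖u y‖ ^ 2) (volume.restrict D) := (hint1.sub hint2).congr hfu
  have hval : ∫ y in D, ‖u y‖ ^ 2 = (∫ y in D, ‖f y‖ ^ 2) - ∑ k ∈ Finset.range N, ev k := by
    rw [← integral_congr_ae hfu, integral_sub hint1 hint2,
      integral_finsetSum _ fun (k : Fin N) _ => integrable_inner_sq f (g k), Finset.sum_range]
    simp only [hg]
  have herr := eLpNorm_two_sq_eq_ofReal hmeas hu hint
  refine ⟨Ψ, Ξ, hΨ, hΞ, ⟨hmeas, ?_⟩, ?_⟩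
  -- The squared norm is an `ENNReal.ofReal` by `herr`, hence finite.
  · refine lt_top_iff_ne_top.2 fun h => ?_
    rw [h] at herr
    simp at herr
  · rw [← ENNReal.toReal_pow, herr, ENNReal.toReal_ofReal (integral_nonneg fun _ => sq_nonneg _),
      hval]
    simpa only [add_comm] using (hasSum_nat_add_iff' N).2 hsum
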